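/- Rings are associative and commutative, not necessarily with an identity. An $l_u$-ring is a ring $R$ with a lattice order such that $x\le y$ implies $x+z\le y+z$, and $0\le x,\ 0\le y$ imply $0\le xy$, together with a strong unit $u$: an element $u\ge 0$ such that every $x\in R$ satisfies $|x|\le nu$ for some integer $n\ge 0$. It is semi-low if $ab\le a\wedge b$ for all $a,b\in[0,u]$. An $l$-ideal of $R$ is an additive subgroup $J$ such that $x\in J$ and $|y|\le |x|$ imply $y\in J$; the quotient $R/J$ is then a lattice-ordered group, with $[x]\vee[y]=[x\vee y]$ and $[x]\wedge[y]=[x\wedge y]$. An $l$-ideal $P$ is prime if $R/P$ is totally ordered. Let $\mathrm{Spec}_g(R)$ be the set of prime $l$-ideals. **Theorem.** Let $R$ be a semi-low $l_u$-ring with strong unit $u$. Then every $P\in\mathrm{Spec}_g(R)$ is a ring ideal, every quotient $R/P$ is a totally ordered semi-low $l_u$-ring with strong unit $[u]_P$, and the map $$R\longrightarrow\prod_{P\in\mathrm{Spec}_g(R)}R/P,\qquad x\longmapsto([x]_P)_P,$$ is an injective homomorphism: it preserves sum, product, $\vee$ and $\wedge$ (all taken componentwise in the product) and sends $u$ to $([u]_P)_P$.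 Its composition with each projection to $R/P$ is surjective, so $R$ is isomorphic to a subdirect product of totally ordered semi-low $l_u$-rings. -/

import Mathlib

/-- A (commutative, associative, not necessarily unital) lattice-ordered ring: the order is
compatible with the sum (`IsOrderedAddMonoid`) and products of non-negative elements are
non-negative. -/
class IsLRing (R : Type*) [NonUnitalCommRing R] [Lattice R] : Prop extends
    IsOrderedAddMonoid R where
  mul_nonneg : ∀ x y : R, 0 ≤ x → 0 ≤ y → 0 ≤ x * y

/-- `u` is a strong unit of the lattice-ordered abelian group `G`. -/
def IsStrongUnit {G : Type*} [AddCommGroup G] [Lattice G] (u : G) : Prop :=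
  0 ≤ u ∧ ∀ x : G, ∃ n : ℕ, |x| ≤ n • u

/-- `R` with strong unit `u` is semi-low: `a b ≤ a ∧ b` for all `a, b` in the segment `[0, u]`. -/
def IsSemiLow {R : Type*} [NonUnitalCommRing R] [Lattice R] (u : R) : Prop :=
  ∀ a ∈ Set.Icc 0 u, ∀ b ∈ Set.Icc 0 u, a * b ≤ a ⊓ b

/-- `R` is an `l_u`-ring with strong unit `u`, and it is semi-low. -/
structure IsSemiLowLURing (R : Type*) [NonUnitalCommRing R] [Lattice R] (u : R) : Prop where
  isLRing : IsLRing R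
  isStrongUnit : IsStrongUnit u
  isSemiLow : IsSemiLow u

/-- An `l`-ideal of a lattice-ordered abelian group. -/
structure LIdeal (G : Type*) [AddCommGroup G] [Lattice G] extends AddSubgroup G where
  solid : ∀ x y : G, x ∈ toAddSubgroup → |y| ≤ |x| → y ∈ toAddSubgroup

namespace LIdeal

section Group

variable {G : Type*} [AddCommGroup G] [Lattice G]

/-- The quotient `G / J`. -/
def Quotient (J : LIdeal G) : Type _ := G ⧸ J.toAddSubgroup

instance (J : LIdeal G) : AddCommGroup J.Quotient :=
  inferInstanceAs (AddCommGroup (G ⧸ J.toAddSubgroup))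

/-- The class `[x]_J`. -/
def cls (J : LIdeal G) (x : G) : J.Quotient := QuotientAddGroup.mk x

theorem cls_surjective (J : LIdeal G) : Function.Surjective J.cls :=
  QuotientAddGroup.mk_surjective

theorem cls_eq_cls (J : LIdeal G) {x y : G} : J.cls x = J.cls y ↔ y - x ∈ J.toAddSubgroup := by
  rw [cls, cls]
  refine QuotientAddGroup.eq.trans ?_
  rw [neg_add_eq_sub]

variable [IsOrderedAddMonoid G]

theorem cls_sup_congr (J : LIdeal G) {x x' y y' : G} (hx : J.cls x = J.cls x')
    (hy : J.cls y = J.cls y') : J.cls (x ⊔ y) = J.cls (x' ⊔ y') := by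
  rw [cls_eq_cls] at hx hy
  have h1 : J.cls (x ⊔ y) = J.cls (x' ⊔ y) :=
    J.cls_eq_cls.2 (J.solid _ _ hx (abs_sup_sub_sup_le_abs x' x y))
  have h2 : J.cls (x' ⊔ y) = J.cls (x' ⊔ y') := by
    refine J.cls_eq_cls.2 (J.solid _ _ hy ?_)
    rw [sup_comm x' y', sup_comm x' y]
    exact abs_sup_sub_sup_le_abs y' y x'
  exact h1.trans h2

theorem cls_inf_congr (J : LIdeal G) {x x' y y' : G} (hx : J.cls x = J.cls x')
    (hy : J.cls y = J.cls y') : J.cls (x ⊓ y) = J.cls (x' ⊓ y') := by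
  rw [cls_eq_cls] at hx hy
  have h1 : J.cls (x ⊓ y) = J.cls (x' ⊓ y) :=
    J.cls_eq_cls.2 (J.solid _ _ hx (abs_inf_sub_inf_le_abs x' x y))
  have h2 : J.cls (x' ⊓ y) = J.cls (x' ⊓ y') := by
    refine J.cls_eq_cls.2 (J.solid _ _ hy ?_)
    rw [inf_comm x' y', inf_comm x' y]
    exact abs_inf_sub_inf_le_abs y' y x'
  exact h1.trans h2

/-- `[x] ⊔ [y] = [x ⊔ y]`. -/
def quotientSup (J : LIdeal G) : J.Quotient → J.Quotient → J.Quotient :=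
  _root_.Quotient.map₂ (· ⊔ ·) fun _ _ hx _ _ hy =>
    _root_.Quotient.exact (J.cls_sup_congr (_root_.Quotient.sound hx) (_root_.Quotient.sound hy))

/-- `[x] ⊓ [y] = [x ⊓ y]`. -/
def quotientInf (J : LIdeal G) : J.Quotient → J.Quotient → J.Quotient :=
  _root_.Quotient.map₂ (· ⊓ ·) fun _ _ hx _ _ hy =>
    _root_.Quotient.exact (J.cls_inf_congr (_root_.Quotient.sound hx) (_root_.Quotient.sound hy))

/-- The quotient lattice: `[x] ⊔ [y] = [x ⊔ y]`, `[x] ⊓ [y] = [x ⊓ y]`, and `a ≤ b` means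
`a ⊔ b = b`. -/
instance (J : LIdeal G) : Lattice J.Quotient :=
  @Lattice.mk' _ ⟨J.quotientSup⟩ ⟨J.quotientInf⟩
    (J.cls_surjective.forall₂.2 fun x y => congrArg J.cls (sup_comm x y))
    (J.cls_surjective.forall₃.2 fun x y z => congrArg J.cls (sup_assoc x y z))
    (J.cls_surjective.forall₂.2 fun x y => congrArg J.cls (inf_comm x y))
    (J.cls_surjective.forall₃.2 fun x y z => congrArg J.cls (inf_assoc x y z))
    (J.cls_surjective.forall₂.2 fun _ _ => congrArg J.cls sup_inf_self)
    (J.cls_surjective.forall₂.2 fun _ _ => congrArg J.cls inf_sup_self)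

theorem cls_sup (J : LIdeal G) (x y : G) : J.cls (x ⊔ y) = J.cls x ⊔ J.cls y := rfl

theorem cls_inf (J : LIdeal G) (x y : G) : J.cls (x ⊓ y) = J.cls x ⊓ J.cls y := rfl

/-- An `l`-ideal `P` of `G` is prime when `G / P` is a chain. -/
def IsPrime (P : LIdeal G) : Prop := ∀ a b : P.Quotient, a ≤ b ∨ b ≤ a

end Group

section Ring

variable {R : Type*} [NonUnitalCommRing R] [Lattice R]

/-- An `l`-ideal of the additive group of `R` is an `L`-ideal when it absorbs products. -/
class IsRingIdeal (J : LIdeal R) : Prop where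
  mul_mem : ∀ x y : R, y ∈ J.toAddSubgroup → x * y ∈ J.toAddSubgroup

theorem cls_mul_congr (J : LIdeal R) [J.IsRingIdeal] {x x' y y' : R} (hx : J.cls x = J.cls x')
    (hy : J.cls y = J.cls y') : J.cls (x * y) = J.cls (x' * y') := by
  rw [cls_eq_cls] at hx hy ⊢
  have h : x' * y' - x * y = y' * (x' - x) + x * (y' - y) := by
    rw [mul_sub, mul_sub, mul_comm y' x', mul_comm y' x]
    abel
  rw [h]
  exact J.add_mem (IsRingIdeal.mul_mem _ _ hx) (IsRingIdeal.mul_mem _ _ hy)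

instance (J : LIdeal R) [J.IsRingIdeal] : Mul J.Quotient where
  mul := _root_.Quotient.map₂ (· * ·) fun _ _ hx _ _ hy =>
    _root_.Quotient.exact (J.cls_mul_congr (_root_.Quotient.sound hx) (_root_.Quotient.sound hy))

theorem cls_add (J : LIdeal R) (x y : R) : J.cls (x + y) = J.cls x + J.cls y := rfl

theorem cls_mul (J : LIdeal R) [J.IsRingIdeal] (x y : R) : J.cls (x * y) = J.cls x * J.cls y := rfl

theorem cls_zero (J : LIdeal R) : J.cls 0 = 0 := rfl

/-- The quotient ring of `R` by an `L`-ideal, `[x] [y] = [x y]`. -/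
instance (J : LIdeal R) [J.IsRingIdeal] : NonUnitalCommRing J.Quotient :=
  { (inferInstance : AddCommGroup J.Quotient), (inferInstance : Mul J.Quotient) with
    left_distrib := J.cls_surjective.forall₃.2 fun x y z => by
      simp only [← cls_add, ← cls_mul, mul_add]
    right_distrib := J.cls_surjective.forall₃.2 fun x y z => by
      simp only [← cls_add, ← cls_mul, add_mul]
    zero_mul := J.cls_surjective.forall.2 fun x => by rw [← cls_zero, ← cls_mul, zero_mul]
    mul_zero := J.cls_surjective.forall.2 fun x => by rw [← cls_zero, ← cls_mul, mul_zero]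
    mul_assoc := J.cls_surjective.forall₃.2 fun x y z => by simp only [← cls_mul, mul_assoc]
    mul_comm := J.cls_surjective.forall₂.2 fun x y => by rw [← cls_mul, ← cls_mul, mul_comm] }

end Ring

end LIdeal

/-- The spectrum of a lattice-ordered abelian group: its prime `l`-ideals. -/
def LSpectrum (G : Type*) [AddCommGroup G] [Lattice G] [IsOrderedAddMonoid G] : Type _ :=
  {P : LIdeal G // P.IsPrime}

/-- The quotient `R / P` at a point of the spectrum. -/
abbrev LSpectrum.Fiber {G : Type*} [AddCommGroup G] [Lattice G] [IsOrderedAddMonoid G]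
    (P : LSpectrum G) : Type _ :=
  P.1.Quotient

/-- `x ↦ ([x]_P)_P`. -/
def toFibers (G : Type*) [AddCommGroup G] [Lattice G] [IsOrderedAddMonoid G] (x : G) :
    ∀ P : LSpectrum G, P.Fiber :=
  fun P => P.1.cls x

/-- `f` preserves the ring operations, the lattice operations and the distinguished element. -/
structure IsLURingHom {R S : Type*} [NonUnitalCommRing R] [Lattice R] [NonUnitalCommRing S]
    [Lattice S] (u : R) (v : S) (f : R → S) : Prop where
  map_add : ∀ x y, f (x + y) = f x + f y
  map_mul : ∀ x y, f (x * y) = f x * f y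
  map_sup : ∀ x y, f (x ⊔ y) = f x ⊔ f y
  map_inf : ∀ x y, f (x ⊓ y) = f x ⊓ f y
  map_unit : f u = v

section LatticeOrderedGroup

variable {G : Type*} [AddCommGroup G] [Lattice G]

/-! Two independent facts carry the theorem. Absorption: semi-lowness yields `u * y ≤ y` for every
`y ≥ 0`, so `|x| ≤ n • u` gives `|x * y| ≤ n • |y|`, and every `l`-ideal, prime or not, is a ring
ideal (`IsSemiLow.isRingIdeal`). Separation uses the ordered group alone: an `l`-ideal maximal among
those avoiding a given `x ≠ 0` is prime (`LIdeal.exists_isPrime_notMem`). If `a ⊓ b = 0` with both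
`a` and `b` outside it, `x` would lie in both enlargements, by `a` and by `b`, but these meet in the
original ideal. The quotients inherit the axioms because inequalities between classes lift to
suitably truncated representatives. -/

theorem LIdeal.mem_of_abs_le (J : LIdeal G) {x y : G} (hx : x ∈ J.toAddSubgroup) (h : |y| ≤ x) :
    y ∈ J.toAddSubgroup :=
  J.solid _ _ hx (h.trans (le_abs_self x))

variable [IsOrderedAddMonoid G]

theorem inf_add_le_inf_add_inf {a b c : G} (ha : 0 ≤ a) (hb : 0 ≤ b) (hc : 0 ≤ c) :
    a ⊓ (b + c) ≤ a ⊓ b + a ⊓ c := by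
  have h₁ : a ⊓ (b + c) - c ≤ a ⊓ b :=
    le_inf (sub_le_iff_le_add.2 (inf_le_left.trans (le_add_of_nonneg_right hc)))
      (sub_le_iff_le_add.2 inf_le_right)
  rw [← sub_le_iff_le_add']
  refine le_inf ?_ ?_
  · exact sub_le_iff_le_add.2 (inf_le_left.trans (le_add_of_nonneg_right (le_inf ha hb)))
  · rwa [sub_le_comm]

theorem inf_nsmul_le_nsmul_inf {a b : G} (ha : 0 ≤ a) (hb : 0 ≤ b) (n : ℕ) :
    a ⊓ n • b ≤ n • (a ⊓ b) := by
  induction n with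
  | zero => simp
  | succ n ih =>
    rw [succ_nsmul, succ_nsmul]
    exact (inf_add_le_inf_add_inf ha (nsmul_nonneg hb n) hb).trans (add_le_add_left ih _)

theorem nsmul_inf_nsmul_le_zero {a b : G} (h : a ⊓ b = 0) (m n : ℕ) : m • a ⊓ n • b ≤ 0 := by
  have ha : 0 ≤ a := h ▸ inf_le_left
  have hb : 0 ≤ b := h ▸ inf_le_right
  have h₁ : b ⊓ m • a ≤ 0 := by
    simpa [inf_comm b a, h] using inf_nsmul_le_nsmul_inf hb ha m
  have h₂ : m • a ⊓ b = 0 :=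
    le_antisymm (by rwa [inf_comm]) (le_inf (nsmul_nonneg ha m) hb)
  simpa [h₂] using inf_nsmul_le_nsmul_inf (nsmul_nonneg ha m) hb n

/-- The excess `c - (p + q)` lies below both `m • a` and `n • b`, and multiples of disjoint elements
remain disjoint. -/
theorem le_of_le_add_nsmul {a b c p q : G} (h : a ⊓ b = 0) (hp : 0 ≤ p) (hq : 0 ≤ q) {m n : ℕ}
    (ha : c ≤ p + m • a) (hb : c ≤ q + n • b) : c ≤ p + q := by
  have h₁ : c - (p + q) ≤ m • a ⊓ n • b := by
    refine le_inf (sub_le_iff_le_add'.2 (ha.trans ?_)) (sub_le_iff_le_add'.2 (hb.trans ?_))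
    · exact add_le_add_left (le_add_of_nonneg_right hq) _
    · exact add_le_add_left (le_add_of_nonneg_left hp) _
  exact sub_nonpos.1 (h₁.trans (nsmul_inf_nsmul_le_zero h m n))

namespace LIdeal

theorem abs_mem_iff (J : LIdeal G) {x : G} : |x| ∈ J.toAddSubgroup ↔ x ∈ J.toAddSubgroup :=
  ⟨fun h => J.solid _ _ h (abs_abs x).ge, fun h => J.solid _ _ h (abs_abs x).le⟩

/-- The `l`-ideal generated by `J` and an element `a ≥ 0`. -/
def adjoin (J : LIdeal G) (a : G) : LIdeal G where
  carrier := {x | ∃ p ∈ J.toAddSubgroup, ∃ n : ℕ, |x| ≤ p + n • a}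
  zero_mem' := ⟨0, J.zero_mem, 0, by simp⟩
  add_mem' := by
    rintro x y ⟨p, hp, m, hx⟩ ⟨q, hq, n, hy⟩
    refine ⟨p + q, J.add_mem hp hq, m + n, ?_⟩
    rw [add_nsmul, add_add_add_comm]
    exact (abs_add_le x y).trans (add_le_add hx hy)
  neg_mem' := by
    rintro x ⟨p, hp, n, hx⟩
    exact ⟨p, hp, n, by rwa [abs_neg]⟩
  solid := by
    rintro x y ⟨p, hp, n, hx⟩ hxy
    exact ⟨p, hp, n, hxy.trans hx⟩

theorem le_adjoin (J : LIdeal G) (a : G) : J.toAddSubgroup ≤ (J.adjoin a).toAddSubgroup :=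
  fun x hx => ⟨|x|, J.abs_mem_iff.2 hx, 0, by simp⟩

theorem self_mem_adjoin (J : LIdeal G) {a : G} (ha : 0 ≤ a) : a ∈ (J.adjoin a).toAddSubgroup :=
  ⟨0, J.zero_mem, 1, by simp [abs_of_nonneg ha]⟩

theorem mem_of_mem_adjoin_of_mem_adjoin (J : LIdeal G) {a b x : G} (h : a ⊓ b = 0)
    (ha : x ∈ (J.adjoin a).toAddSubgroup) (hb : x ∈ (J.adjoin b).toAddSubgroup) :
    x ∈ J.toAddSubgroup := by
  obtain ⟨p, hp, m, hm⟩ := ha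
  obtain ⟨q, hq, n, hn⟩ := hb
  exact J.mem_of_abs_le (J.add_mem (J.abs_mem_iff.2 hp) (J.abs_mem_iff.2 hq))
    (le_of_le_add_nsmul h (abs_nonneg p) (abs_nonneg q)
      (hm.trans (add_le_add_left (le_abs_self p) _))
      (hn.trans (add_le_add_left (le_abs_self q) _)))

/-- The quotient order: a class is at most another when the positive part of the difference lies
in the `l`-ideal. -/
theorem cls_le_cls (J : LIdeal G) {x y : G} :
    J.cls x ≤ J.cls y ↔ (x - y) ⊔ 0 ∈ J.toAddSubgroup := by
  rw [← sup_eq_right, ← cls_sup, eq_comm, cls_eq_cls, sup_sub, sub_self]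

/-- The positive and negative parts of `x - y` are disjoint, and membership of either one in `J` is
one of the two comparisons between the classes. -/
theorem isPrime_of_disjoint (J : LIdeal G)
    (h : ∀ a b : G, a ⊓ b = 0 → a ∈ J.toAddSubgroup ∨ b ∈ J.toAddSubgroup) : J.IsPrime := by
  refine J.cls_surjective.forall₂.2 fun x y => ?_
  rw [cls_le_cls, cls_le_cls]
  refine h _ _ ?_
  have := posPart_inf_negPart_eq_zero (x - y)
  rwa [posPart_def, negPart_def, neg_sub] at this

/-- Every nonzero element is avoided by a prime `l`-ideal. -/
theorem exists_isPrime_notMem {x : G} (hx : x ≠ 0) :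
    ∃ P : LIdeal G, P.IsPrime ∧ x ∉ P.toAddSubgroup := by
  let S : Set (AddSubgroup G) := {H | (∀ a b : G, a ∈ H → |b| ≤ |a| → b ∈ H) ∧ x ∉ H}
  have hbot : (⊥ : AddSubgroup G) ∈ S := by
    refine ⟨fun a b ha hab => ?_, fun h => hx (AddSubgroup.mem_bot.1 h)⟩
    rw [AddSubgroup.mem_bot] at ha ⊢
    rw [ha, abs_zero] at hab
    exact le_antisymm ((le_abs_self b).trans hab) (neg_nonpos.1 ((neg_le_abs b).trans hab))
  obtain ⟨M, -, hM⟩ := zorn_le_nonempty₀ S (fun c hc hchain H hH => by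
    -- The supremum of a nonempty chain is its union, so solidity and avoidance of `x` pass to it.
    have hmem : ∀ {a : G}, a ∈ sSup c ↔ ∃ K ∈ c, a ∈ K :=
      AddSubgroup.mem_sSup_of_directedOn ⟨H, hH⟩ hchain.directedOn
    refine ⟨sSup c, ⟨fun a b ha hab => ?_, fun h => ?_⟩, fun K hK => le_sSup hK⟩
    · obtain ⟨K, hK, haK⟩ := hmem.1 ha
      exact hmem.2 ⟨K, hK, (hc hK).1 a b haK hab⟩
    · obtain ⟨K, hK, hxK⟩ := hmem.1 h
      exact (hc hK).2 hxK) ⊥ hbot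
  let P : LIdeal G := ⟨M, hM.prop.1⟩
  -- By maximality, a strictly larger `l`-ideal must contain `x`.
  have key : ∀ a : G, 0 ≤ a → a ∉ P.toAddSubgroup → x ∈ (P.adjoin a).toAddSubgroup := by
    intro a ha haP
    by_contra hxa
    exact haP (hM.le_of_ge ⟨(P.adjoin a).solid, hxa⟩ (P.le_adjoin a) (P.self_mem_adjoin ha))
  refine ⟨P, P.isPrime_of_disjoint fun a b hab => ?_, hM.prop.2⟩
  by_contra! h
  exact hM.prop.2 (P.mem_of_mem_adjoin_of_mem_adjoin hab (key a (hab ▸ inf_le_left) h.1)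
    (key b (hab ▸ inf_le_right) h.2))

theorem isStrongUnit_cls (J : LIdeal G) {u : G} (hu : IsStrongUnit u) :
    IsStrongUnit (J.cls u) := by
  have mono : ∀ {x y : G}, x ≤ y → J.cls x ≤ J.cls y := fun {x y} h => by
    rw [← sup_eq_right, ← cls_sup, sup_eq_right.2 h]
  refine ⟨mono hu.1, J.cls_surjective.forall.2 fun x => ?_⟩
  obtain ⟨n, hn⟩ := hu.2 x
  exact ⟨n, mono hn⟩

end LIdeal

theorem toFibers_injective : Function.Injective (toFibers G) := by
  intro x y h
  by_contra hxy
  obtain ⟨P, hP, hmem⟩ := LIdeal.exists_isPrime_notMem (sub_ne_zero.2 (Ne.symm hxy))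
  exact hmem (P.cls_eq_cls.1 (congrFun h ⟨P, hP⟩))

end LatticeOrderedGroup

section LRing

variable {R : Type*} [NonUnitalCommRing R] [Lattice R] [IsLRing R]

theorem IsLRing.mul_le_mul_left {x y z : R} (hz : 0 ≤ z) (h : x ≤ y) : z * x ≤ z * y := by
  rw [← sub_nonneg, ← mul_sub]
  exact IsLRing.mul_nonneg _ _ hz (sub_nonneg.2 h)

theorem IsLRing.abs_mul_le (x y : R) : |x * y| ≤ |x| * |y| := by
  have key : ∀ a b : R, a ≤ |x| → -a ≤ |x| → b ≤ |y| → -b ≤ |y| → a * b ≤ |x| * |y| := by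
    intro a b ha ha' hb hb'
    -- The products `(|x| - a)(|y| + b)` and `(|x| + a)(|y| - b)` are nonnegative and sum to twice
    -- `|x| * |y| - a * b`.
    have h₁ := IsLRing.mul_nonneg _ _ (sub_nonneg.2 ha) (sub_nonneg.2 hb')
    have h₂ := IsLRing.mul_nonneg _ _ (sub_nonneg.2 ha') (sub_nonneg.2 hb)
    have h₃ : 0 ≤ |x| * |y| + |x| * |y| - (a * b + a * b) :=
      (add_nonneg h₁ h₂).trans_eq (by
        simp only [sub_mul, mul_sub, neg_mul, mul_neg]
        abel)
    rw [add_sub_add_comm, ← two_nsmul] at h₃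
    exact sub_nonneg.1 (nsmul_two_semiclosed h₃)
  refine abs_le'.2 ⟨key x y (le_abs_self x) (neg_le_abs x) (le_abs_self y) (neg_le_abs y), ?_⟩
  rw [← neg_mul]
  exact key (-x) y (neg_le_abs x) (by rw [neg_neg]; exact le_abs_self x) (le_abs_self y)
    (neg_le_abs y)

namespace IsSemiLow

variable {u : R}

/-- Split `y` as `y ⊓ u`, where semi-lowness applies directly, plus the remainder `0 ⊔ (y - u)`,
which needs one multiple of `u` fewer. -/
theorem mul_le_of_le_nsmul (hu : IsSemiLow u) (hu₀ : 0 ≤ u) (n : ℕ) {y : R} (hy : 0 ≤ y)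
    (hyn : y ≤ n • u) : u * y ≤ y := by
  induction n generalizing y with
  | zero =>
    rw [zero_nsmul] at hyn
    rw [le_antisymm hyn hy, mul_zero]
  | succ n ih =>
    have h₁ : u * (y ⊓ u) ≤ y ⊓ u :=
      (hu u ⟨hu₀, le_rfl⟩ (y ⊓ u) ⟨le_inf hy hu₀, inf_le_right⟩).trans inf_le_right
    have h₂ : u * (y - y ⊓ u) ≤ y - y ⊓ u := by
      refine ih (sub_nonneg.2 inf_le_left) ?_
      rw [sub_inf, sub_self]
      refine sup_le (nsmul_nonneg hu₀ n) (sub_le_iff_le_add.2 ?_)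
      rwa [← succ_nsmul]
    have h₃ := add_le_add h₁ h₂
    rwa [← mul_add, add_sub_cancel] at h₃

theorem isRingIdeal (hu : IsSemiLow u) (hs : IsStrongUnit u) (J : LIdeal R) : J.IsRingIdeal where
  mul_mem x y hy := by
    obtain ⟨n, hn⟩ := hs.2 x
    obtain ⟨m, hm⟩ := hs.2 y
    refine J.mem_of_abs_le (J.nsmul_mem (J.abs_mem_iff.2 hy) n) ?_
    calc |x * y| ≤ |x| * |y| := IsLRing.abs_mul_le x y
      _ = |y| * |x| := mul_comm _ _
      _ ≤ |y| * (n • u) := IsLRing.mul_le_mul_left (abs_nonneg y) hn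
      _ = n • (u * |y|) := by rw [mul_smul_comm, mul_comm]
      _ ≤ n • |y| := nsmul_le_nsmul_right (hu.mul_le_of_le_nsmul hs.1 m (abs_nonneg y) hm) n

end IsSemiLow

namespace LIdeal

variable (J : LIdeal R) [J.IsRingIdeal]

theorem isLRing_quotient : IsLRing J.Quotient where
  add_le_add_left := J.cls_surjective.forall₂.2 fun x y h => J.cls_surjective.forall.2 fun z => by
    rw [← cls_add, ← cls_add, cls_le_cls, add_sub_add_right_eq_sub]
    exact J.cls_le_cls.1 h
  mul_nonneg := J.cls_surjective.forall₂.2 fun x y hx hy => by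
    -- Nonnegative classes have nonnegative representatives.
    have hx' : J.cls (0 ⊔ x) = J.cls x := sup_eq_right.2 hx
    have hy' : J.cls (0 ⊔ y) = J.cls y := sup_eq_right.2 hy
    rw [← hx', ← hy', ← cls_mul, ← cls_zero, ← sup_eq_right, ← cls_sup,
      sup_eq_right.2 (IsLRing.mul_nonneg _ _ le_sup_left le_sup_left)]

theorem isSemiLow_cls {u : R} (hu₀ : 0 ≤ u) (hu : IsSemiLow u) : IsSemiLow (J.cls u) := by
  have lift : ∀ a ∈ Set.Icc (0 : J.Quotient) (J.cls u), ∃ x ∈ Set.Icc 0 u, J.cls x = a := by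
    -- Truncating a representative to `[0, u]` does not change a class already between `0` and
    -- `[u]`.
    refine J.cls_surjective.forall.2 fun x hx => ⟨(0 ⊔ x) ⊓ u, ⟨le_inf le_sup_left hu₀,
      inf_le_right⟩, ?_⟩
    rw [cls_inf, cls_sup, cls_zero, sup_eq_right.2 hx.1, inf_eq_left.2 hx.2]
  intro a ha b hb
  obtain ⟨x, hx, rfl⟩ := lift a ha
  obtain ⟨y, hy, rfl⟩ := lift b hb
  rw [← cls_mul, ← cls_inf, ← sup_eq_right, ← cls_sup, sup_eq_right.2 (hu x hx y hy)]

end LIdeal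

end LRing

theorem mainTheorem8 {R : Type*} [NonUnitalCommRing R] [Lattice R] [IsLRing R] (u : R)
    (hR : IsSemiLowLURing R u) :
    -- every prime `l`-ideal is an ideal of the ring, so each `R / P` is a ring, and
    ∃ _ : ∀ P : LSpectrum R, P.1.IsRingIdeal,
      -- each `R / P` is a chain semi-low `l_u`-ring with strong unit `[u]_P`,
      (∀ P : LSpectrum R,
        IsSemiLowLURing P.Fiber (P.1.cls u) ∧ ∀ a b : P.Fiber, a ≤ b ∨ b ≤ a) ∧
      -- and `x ↦ ([x]_P)_P` is a subdirect embedding into the product.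
      IsLURingHom u (fun P : LSpectrum R => P.1.cls u) (toFibers R) ∧
      Function.Injective (toFibers R) ∧
      ∀ P : LSpectrum R, Function.Surjective fun x : R => toFibers R x P := by
  refine ⟨fun P => hR.isSemiLow.isRingIdeal hR.isStrongUnit P.1, fun P => ⟨?_, P.2⟩, ?_,
    toFibers_injective, fun P => P.1.cls_surjective⟩
  · have := hR.isSemiLow.isRingIdeal hR.isStrongUnit P.1
    exact ⟨P.1.isLRing_quotient, P.1.isStrongUnit_cls hR.isStrongUnit,
      P.1.isSemiLow_cls hR.isStrongUnit.1 hR.isSemiLow⟩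
  · have := fun P : LSpectrum R => hR.isSemiLow.isRingIdeal hR.isStrongUnit P.1
    exact ⟨fun _ _ => rfl, fun _ _ => rfl, fun _ _ => rfl, fun _ _ => rfl, rfl⟩
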